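/- Consider a repeated contracting problem with binary outcomes $y\in\{0,1\}$. The agent has an action space $[0,1]$ and a cost function $c:[0,1]\to\mathbb{R}$ that is continuous, increasing and strictly convex with $c(0)=0$; action $a$ leads to outcome $1$ with probability $a$. A linear contract $\beta\in[0,1]$ pays the agent $\beta y$. The (myopic) agent responds to it with his best response $a_c(\beta)$, the unique maximizer of $\beta a-c(a)$ over $a\in[0,1]$, so that the principal's expected one-round utility is $u_c(\beta)=(1-\beta)\,a_c(\beta)$. In each round $t=1,2,\dots$ the principal, who does not know $c$ and does not observe the action, posts a linear contract $\beta_t\in[0,1]$, possibly at random, as a function of the past contracts and outcomes $(\beta_s,y_s)_{s<t}$ (a contracting strategy $S$), and then observes $y_t\sim\mathrm{Bernoulli}(a_c(\beta_t))$. The regret of $S$ over $T$ rounds against $c$ is $$\mathrm{Reg}_T(S,c)=T\sup_{\beta\in[0,1]}u_c(\beta)-\mathbb{E}\Big[\sum_{t=1}^{T}(1-\beta_t)y_t\Big],$$ with the expectation over the outcomes and the randomization of $S$. Theorem. There exist a probability distribution $\mu$ over cost functions and a constant $C>0$ such that for every number of rounds $T$ and every contracting strategy $S$, when the cost function $c$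 is sampled once from $\mu$ and then kept for all rounds, the principal incurs expected regret $$\mathbb{E}_{c\sim\mu}\big[\mathrm{Reg}_T(S,c)\big]\ \ge\ C\sqrt{T}.$$ -/

import Mathlib

open MeasureTheory ProbabilityTheory
open scoped unitInterval

noncomputable section

namespace LinearContract

/-- Cost functions of the agent on the action space `[0,1]`: increasing, convex, `c 0 = 0`.
Continuity and strict convexity make the best response to each contract exist and be unique.
Only the values on `[0,1]` matter. -/
structure CostFunction where
  toFun : ℝ → ℝ
  map_zero : toFun 0 = 0
  continuousOn : ContinuousOn toFun (Set.Icc 0 1)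
  monotoneOn : MonotoneOn toFun (Set.Icc 0 1)
  strictConvexOn : StrictConvexOn ℝ (Set.Icc 0 1) toFun

instance : CoeFun CostFunction (fun _ => ℝ → ℝ) := ⟨CostFunction.toFun⟩

/-- The σ-algebra generated by the evaluations `c ↦ c a`, `a ∈ [0,1]`. -/
instance : MeasurableSpace CostFunction :=
  MeasurableSpace.comap (fun (c : CostFunction) (a : I) => c a) MeasurableSpace.pi

/-- Expected utility of the agent who takes action `a` (the success probability) under the linear
contract that pays him the share `β` of the outcome. -/
def agentUtility (c : CostFunction) (β a : I) : ℝ := (β : ℝ) * a - c a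

/-- `a` is incentive compatible under the contract `β`. -/
def IsBestResponse (c : CostFunction) (β a : I) : Prop :=
  ∀ a' : I, agentUtility c β a' ≤ agentUtility c β a

theorem exists_isBestResponse (c : CostFunction) (β : I) : ∃ a : I, IsBestResponse c β a := by
  have hc : Continuous fun a : I => c a :=
    continuousOn_iff_continuous_domRestrict.1 c.continuousOn
  have hcont : Continuous fun a : I => agentUtility c β a := by
    unfold agentUtility
    exact (continuous_const.mul continuous_subtype_val).sub hc
  obtain ⟨a, -, ha⟩ := isCompact_univ.exists_isMaxOn (Set.univ_nonempty (α := I))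
    hcont.continuousOn
  exact ⟨a, fun a' => ha (Set.mem_univ a')⟩

/-- The action taken by the agent under the contract `β`. -/
def response (c : CostFunction) (β : I) : I := (exists_isBestResponse c β).choose

theorem isBestResponse_response (c : CostFunction) (β : I) :
    IsBestResponse c β (response c β) := (exists_isBestResponse c β).choose_spec

/-- There are no ties: the response is the only incentive compatible action. -/
theorem IsBestResponse.eq_response {c : CostFunction} {β a : I} (ha : IsBestResponse c β a) :
    a = response c β := by
  by_contra hne
  have hne' : (a : ℝ) ≠ response c β := fun h => hne (Subtype.ext h)
  have hlt := c.strictConvexOn.2 a.2 (response c β).2 hne'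
    (show (0 : ℝ) < 1 / 2 by norm_num) (show (0 : ℝ) < 1 / 2 by norm_num) (by norm_num)
  have hmem := c.strictConvexOn.1 a.2 (response c β).2
    (show (0 : ℝ) ≤ 1 / 2 by norm_num) (show (0 : ℝ) ≤ 1 / 2 by norm_num) (by norm_num)
  have h1 := isBestResponse_response c β ⟨_, hmem⟩
  have h2 := ha ⟨_, hmem⟩
  simp only [agentUtility, smul_eq_mul] at h1 h2 hlt
  linarith

theorem monotone_response (c : CostFunction) : Monotone (response c) := by
  intro β β' h
  rcases h.eq_or_lt with rfl | h
  · exact le_rfl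
  have h1 := isBestResponse_response c β (response c β')
  have h2 := isBestResponse_response c β' (response c β)
  have h3 : (β : ℝ) < β' := h
  simp only [agentUtility] at h1 h2
  have h4 : ((response c β : I) : ℝ) ≤ response c β' := by
    by_contra! h5
    nlinarith
  exact h4

/-- Expected one-round utility of the principal under the contract `β`. -/
def principalUtility (c : CostFunction) (β : I) : ℝ := (1 - (β : ℝ)) * response c β

/-- The law of the binary outcome (`true` is success, `false` is failure) under the contract `β`:
success has probability equal to the action of the agent. -/
def outcomeKernel (c : CostFunction) : Kernel I Bool where
  toFun β := ENNReal.ofReal (response c β) • Measure.dirac true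
    + ENNReal.ofReal (1 - response c β) • Measure.dirac false
  measurable' := by
    have hm : Measurable fun β : I => ((response c β : I) : ℝ) :=
      measurable_subtype_coe.comp (monotone_response c).measurable
    refine Measure.measurable_of_measurable_coe _ fun s _ => ?_
    simp only [Measure.coe_add, Measure.coe_smul, Pi.add_apply, Pi.smul_apply, smul_eq_mul]
    exact (hm.ennreal_ofReal.mul_const _).add
      ((measurable_const.sub hm).ennreal_ofReal.mul_const _)

instance (c : CostFunction) : IsMarkovKernel (outcomeKernel c) where
  isProbabilityMeasure β := ⟨by
    change (ENNReal.ofReal (response c β) • Measure.dirac true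
      + ENNReal.ofReal (1 - response c β) • Measure.dirac false : Measure Bool) Set.univ = 1
    simp only [Measure.coe_add, Measure.coe_smul, Pi.add_apply, Pi.smul_apply, smul_eq_mul,
      measure_univ, mul_one]
    rw [← ENNReal.ofReal_add (response c β).2.1 (sub_nonneg.2 (response c β).2.2)]
    simp⟩

/-- What the principal has seen after `n` rounds: the posted contracts and realized outcomes. -/
def History : ℕ → Type
  | 0 => Unit
  | n + 1 => History n × (I × Bool)

instance instMeasurableSpaceHistory : (n : ℕ) → MeasurableSpace (History n)
  | 0 => inferInstanceAs (MeasurableSpace Unit)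
  | n + 1 =>
    letI := instMeasurableSpaceHistory n
    inferInstanceAs (MeasurableSpace (History n × (I × Bool)))

/-- A (possibly randomized) contracting strategy: after each history, a distribution over the
linear contracts in `[0,1]`, from which the next contract is drawn. -/
structure Strategy where
  post : (n : ℕ) → Kernel (History n) I
  isMarkov : ∀ n, IsMarkovKernel (post n)

instance (S : Strategy) (n : ℕ) : IsMarkovKernel (S.post n) := S.isMarkov n

/-- The law of the contract and the outcome of the next round, given the history. -/
def roundKernel (c : CostFunction) (S : Strategy) (n : ℕ) : Kernel (History n) (I × Bool) :=
  (S.post n) ⊗ₖ (Kernel.prodMkLeft (History n) (outcomeKernel c))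

instance (c : CostFunction) (S : Strategy) (n : ℕ) : IsMarkovKernel (roundKernel c S n) := by
  unfold roundKernel; infer_instance

/-- The law of the history of the first `n` rounds against an agent with cost function `c`. -/
def historyLaw (c : CostFunction) (S : Strategy) : (n : ℕ) → Measure (History n)
  | 0 => Measure.dirac ()
  | n + 1 => (historyLaw c S n) ⊗ₘ (roundKernel c S n)

instance isProbabilityMeasure_historyLaw (c : CostFunction) (S : Strategy) :
    (n : ℕ) → IsProbabilityMeasure (historyLaw c S n)
  | 0 => inferInstanceAs (IsProbabilityMeasure (Measure.dirac ()))
  | n + 1 =>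
    haveI := isProbabilityMeasure_historyLaw c S n
    inferInstanceAs (IsProbabilityMeasure ((historyLaw c S n) ⊗ₘ (roundKernel c S n)))

/-- The total utility `∑ (1 - β_t) y_t` that the principal has collected. -/
def collected : (n : ℕ) → History n → ℝ
  | 0, _ => 0
  | n + 1, (h, β, y) => collected n h + (1 - (β : ℝ)) * (if y then 1 else 0)

/-- The regret over `T` rounds, in expectation over outcomes and the strategy's randomization:
the utility of the best fixed linear contract minus the utility collected by the strategy. -/
def regret (c : CostFunction) (S : Strategy) (T : ℕ) : ℝ :=
  (T : ℝ) * (⨆ β : I, principalUtility c β) - ∫ h, collected T h ∂(historyLaw c S T)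

end LinearContract

end

open MeasureTheory ProbabilityTheory
open scoped unitInterval

noncomputable section

namespace LinearContract

/-! The hard costs are built so that near-optimal contracts reveal little about which cost is in
force. In the plane of contract `β` and response `a`, take the level curve `(1 - β) * a = 1/16` of
the principal's utility and its tangent at `β = 1 - d`; this tangent is `line d`. An agent `cost d`
who responds along it has optimal contract `1 - d` with value `1/16` whatever `d` is, and deviating
from `1 - d` costs at least a constant times the squared deviation (`sq_le_principalUtility_gap`).
So regret dominates `totalSqDev`, the expected sum of squared deviations.

Since the lines are tangents to one curve, for `e = d + ε` the responses at `β` differ by only `O(ε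
(ε + |β - (1 - d)|))` (`abs_line_sub_line_le`). Hence the Kullback-Leibler divergence between the
histories under `d` and `e` is `O(ε² (T ε² + totalSqDev d))` (`neg_integral_cumul_logRatio_le`).
Take `ε` a small multiple of `T^(-1/4)`. Either `totalSqDev d` already exceeds `√T`, or the
divergence is a small constant and the two costs cannot be told apart. No contract is close to both
`1 - d` and `1 - e`, so the deviations for `d` and `e` then add up to order `T ε²`, that is `√T`
(`sqrt_le_totalSqDev_add_totalSqDev`).

The prior takes `d` uniform on an interval. Integrating the two-point bound for the pair `d`, `d +
ε` over `d` bounds the average regret, with one prior serving every `T` although `ε` depends on `T`.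
-/

/-! ### Expectations over outcomes, and measurability in the cost function -/

/-- The mean of `g (β, y)` over the outcome `y` of the contract `β`. -/
def outcomeMean (c : CostFunction) (g : I × Bool → ℝ) (β : I) : ℝ :=
  (response c β : ℝ) * g (β, true) + (1 - (response c β : ℝ)) * g (β, false)

theorem integral_outcomeKernel (c : CostFunction) (β : I) (f : Bool → ℝ) :
    ∫ y, f y ∂(outcomeKernel c β)
      = (response c β : ℝ) * f true + (1 - (response c β : ℝ)) * f false := by
  change ∫ y, f y ∂(ENNReal.ofReal (response c β) • Measure.dirac true
    + ENNReal.ofReal (1 - response c β) • Measure.dirac false : Measure Bool) = _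
  rw [integral_add_measure, integral_smul_measure, integral_smul_measure, integral_dirac,
    integral_dirac, ENNReal.toReal_ofReal (response c β).2.1,
    ENNReal.toReal_ofReal (sub_nonneg.2 (response c β).2.2), smul_eq_mul, smul_eq_mul]
  all_goals exact (integrable_dirac enorm_lt_top).smul_measure ENNReal.ofReal_ne_top

theorem abs_outcomeMean_le (c : CostFunction) {g : I × Bool → ℝ} {B : ℝ} (hB : ∀ x, |g x| ≤ B)
    (β : I) : |outcomeMean c g β| ≤ B := by
  have h1 := abs_le.1 (hB (β, true))
  have h2 := abs_le.1 (hB (β, false))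
  have h3 := (response c β).2.1
  have h4 := (response c β).2.2
  unfold outcomeMean
  rw [abs_le]
  constructor <;> nlinarith

theorem measurable_apply (a : I) : Measurable fun c : CostFunction => c a :=
  (measurable_pi_apply a).comp (comap_measurable fun (c : CostFunction) (a : I) => c a)

/-- By strict concavity the agent's utility strictly increases up to the response and strictly
decreases after it, so the response lies left of `r` exactly when some rational point left of `r`
beats `r`. This expresses the event through countably many evaluations of `c`, which is what
measurability in `c` needs. -/
theorem response_lt_iff (c : CostFunction) (β r : I) :
    response c β < r ↔ ∃ q : ℚ, ∃ hq : (q : ℝ) ∈ Set.Icc (0 : ℝ) 1, (q : ℝ) < r ∧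
      agentUtility c β r < agentUtility c β ⟨q, hq⟩ := by
  have key : ∀ x y : I, ∀ t : ℝ, x ≠ y → 0 < t → t < 1 → ∀ z : I,
      (z : ℝ) = t * x + (1 - t) * y →
      t * agentUtility c β x + (1 - t) * agentUtility c β y < agentUtility c β z := by
    intro x y t hne ht ht1 z hz
    have h := c.strictConvexOn.2 x.2 y.2 (fun h => hne (Subtype.ext h)) ht (sub_pos.2 ht1)
      (by ring)
    simp only [smul_eq_mul, ← hz] at h
    simp only [agentUtility, hz] at *
    nlinarith
  have hbest := isBestResponse_response c β
  constructor
  · intro h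
    have h' : (response c β : ℝ) < r := h
    obtain ⟨q, hq1, hq2⟩ := exists_rat_btwn h'
    have hq : (q : ℝ) ∈ Set.Icc (0 : ℝ) 1 :=
      ⟨(response c β).2.1.trans hq1.le, hq2.le.trans r.2.2⟩
    refine ⟨q, hq, hq2, ?_⟩
    have hpos : (0 : ℝ) < r - response c β := sub_pos.2 h'
    have := key (response c β) r ((r - q) / (r - response c β)) h.ne
      (div_pos (by linarith) hpos) ((div_lt_one hpos).2 (by linarith)) ⟨q, hq⟩
      (by field_simp; ring)
    have h0 := hbest r
    have ht : 0 < ((r : ℝ) - q) / (r - response c β) := div_pos (by linarith) hpos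
    nlinarith
  · rintro ⟨q, hq, hlt, hu⟩
    by_contra! hle
    have hle' : (r : ℝ) ≤ response c β := hle
    rcases hle'.eq_or_lt with heq | hlt'
    · have h1 := hbest ⟨q, hq⟩
      rw [← Subtype.ext heq] at h1
      linarith
    · have hpos : (0 : ℝ) < response c β - q := by linarith
      have := key ⟨q, hq⟩ (response c β) ((response c β - r) / (response c β - q))
        (fun h => by have := congrArg Subtype.val h; simp only at this; linarith)
        (div_pos (by linarith) hpos) ((div_lt_one hpos).2 (by linarith)) r
        (by simp only; field_simp; ring)
      have h0 := hbest ⟨q, hq⟩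
      have ht1 : ((response c β : ℝ) - r) / (response c β - q) < 1 :=
        (div_lt_one hpos).2 (by linarith)
      nlinarith

theorem measurable_response : Measurable fun z : CostFunction × I => response z.1 z.2 := by
  refine measurable_of_Iio fun r => ?_
  have : (fun z : CostFunction × I => response z.1 z.2) ⁻¹' Set.Iio r
      = ⋃ q : ℚ, ⋃ hq : (q : ℝ) ∈ Set.Icc (0 : ℝ) 1, ⋃ _ : (q : ℝ) < r,
        {z | agentUtility z.1 z.2 r < agentUtility z.1 z.2 ⟨q, hq⟩} := by
    ext z
    simp [response_lt_iff]
  rw [this]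
  refine .iUnion fun q => .iUnion fun hq => .iUnion fun _ => measurableSet_lt ?_ ?_
  all_goals
    unfold agentUtility
    exact ((measurable_subtype_coe.comp measurable_snd).mul_const _).sub
      ((measurable_apply _).comp measurable_fst)

theorem measurable_response_coe :
    Measurable fun z : CostFunction × I => (response z.1 z.2 : ℝ) :=
  measurable_subtype_coe.comp measurable_response

theorem principalUtility_mem (c : CostFunction) (β : I) :
    principalUtility c β ∈ Set.Icc (0 : ℝ) 1 := by
  have h1 := β.2.1
  have h2 := β.2.2
  have h3 := (response c β).2.1
  have h4 := (response c β).2.2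
  unfold principalUtility
  constructor <;> nlinarith

theorem bddAbove_principalUtility (c : CostFunction) :
    BddAbove (Set.range (principalUtility c)) :=
  ⟨1, by rintro _ ⟨β, rfl⟩; exact (principalUtility_mem c β).2⟩

/-- Raising a contract slightly does not lower the response, so a rational contract just above `β`
loses at most `ε`. At `β = 1` there is no room above, but the utility there is `0`. -/
theorem iSup_principalUtility_eq (c : CostFunction) :
    ⨆ β : I, principalUtility c β
      = ⨆ q : {q : ℚ // (q : ℝ) ∈ Set.Icc (0 : ℝ) 1}, principalUtility c ⟨(q : ℚ), q.2⟩ := by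
  have : Nonempty {q : ℚ // (q : ℝ) ∈ Set.Icc (0 : ℝ) 1} := ⟨⟨0, by simp⟩⟩
  have hbdd : BddAbove (Set.range fun q : {q : ℚ // (q : ℝ) ∈ Set.Icc (0 : ℝ) 1} =>
      principalUtility c ⟨(q : ℚ), q.2⟩) :=
    ⟨1, by rintro _ ⟨q, rfl⟩; exact (principalUtility_mem c _).2⟩
  refine le_antisymm (ciSup_le fun β => ?_)
    (ciSup_le fun q => le_ciSup (bddAbove_principalUtility c) _)
  rcases β.2.2.eq_or_lt with h1 | h1
  · have : principalUtility c β = 0 := by simp [principalUtility, h1]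
    rw [this]
    exact (principalUtility_mem c _).1.trans (le_ciSup hbdd ⟨0, by simp⟩)
  · refine le_of_forall_pos_le_add fun ε hε => ?_
    obtain ⟨q, hq1, hq2⟩ := exists_rat_btwn (lt_min h1 (lt_add_of_pos_right (β : ℝ) hε))
    have hq : (q : ℝ) ∈ Set.Icc (0 : ℝ) 1 :=
      ⟨β.2.1.trans hq1.le, hq2.le.trans (min_le_left _ _)⟩
    have hmono : ((response c β : I) : ℝ) ≤ response c ⟨q, hq⟩ :=
      monotone_response c (show β ≤ ⟨q, hq⟩ from hq1.le)
    have h2 := hq2.trans_le (min_le_right _ _)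
    have h3 := (response c β).2.1
    have h4 := (response c β).2.2
    have h5 : principalUtility c β ≤ principalUtility c ⟨q, hq⟩ + ε := by
      unfold principalUtility
      have := hq.2
      simp only
      nlinarith
    have h6 := le_ciSup hbdd ⟨q, hq⟩
    simp only at h6
    linarith

theorem measurable_iSup_principalUtility :
    Measurable fun c : CostFunction => ⨆ β : I, principalUtility c β := by
  simp_rw [iSup_principalUtility_eq]
  refine Measurable.iSup fun q => ?_
  unfold principalUtility
  exact (measurable_response_coe.comp (measurable_id.prodMk measurable_const)).const_mul _

theorem measurable_outcomeMean {α : Type*} [MeasurableSpace α] {c : α → CostFunction}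
    (hc : Measurable c) {F : α × (I × Bool) → ℝ} (hF : Measurable F) :
    Measurable fun z : α × I => outcomeMean (c z.1) (fun x => F (z.1, x)) z.2 := by
  have hr : Measurable fun z : α × I => (response (c z.1) z.2 : ℝ) :=
    measurable_response_coe.comp ((hc.comp measurable_fst).prodMk measurable_snd)
  have hy : ∀ y : Bool, Measurable fun z : α × I => F (z.1, (z.2, y)) := fun y =>
    hF.comp (measurable_fst.prodMk (measurable_snd.prodMk measurable_const))
  exact (hr.mul (hy true)).add ((measurable_const.sub hr).mul (hy false))

theorem integrable_of_abs_le {α : Type*} [MeasurableSpace α] {μ : Measure α} [IsFiniteMeasure μ]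
    {f : α → ℝ} (hf : Measurable f) {B : ℝ} (hB : ∀ x, |f x| ≤ B) : Integrable f μ :=
  .of_bound hf.aestronglyMeasurable B (.of_forall hB)

theorem abs_integral_le_of_abs_le {α : Type*} [MeasurableSpace α] {μ : Measure α}
    [IsProbabilityMeasure μ] {f : α → ℝ} {B : ℝ} (hB : ∀ x, |f x| ≤ B) : |∫ x, f x ∂μ| ≤ B := by
  simpa using norm_integral_le_of_norm_le_const (μ := μ) (f := f) (.of_forall hB)

theorem integral_historyLaw_succ (c : CostFunction) (S : Strategy) (n : ℕ)
    {F : History n × (I × Bool) → ℝ} (hF : Measurable F) {B : ℝ} (hB : ∀ z, |F z| ≤ B) :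
    ∫ z, F z ∂(historyLaw c S (n + 1))
      = ∫ h, ∫ β, outcomeMean c (fun x => F (h, x)) β ∂(S.post n h) ∂(historyLaw c S n) := by
  change ∫ z, F z ∂((historyLaw c S n) ⊗ₘ (roundKernel c S n)) = _
  rw [Measure.integral_compProd (integrable_of_abs_le hF hB)]
  refine integral_congr_ae (.of_forall fun h => ?_)
  have hFh : Measurable fun x => F (h, x) := hF.comp measurable_prodMk_left
  simp only [roundKernel]
  rw [ProbabilityTheory.integral_compProd (integrable_of_abs_le hFh fun x => hB _)]
  refine integral_congr_ae (.of_forall fun β => ?_)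
  simp only [Kernel.prodMkLeft_apply]
  exact integral_outcomeKernel c β fun y => F (h, (β, y))

/-- Integrating out the last round leaves a bounded measurable function of the cost and the shorter
history, to which induction applies. -/
theorem measurable_integral_historyLaw (S : Strategy) : ∀ (n : ℕ)
    {F : CostFunction × History n → ℝ}, Measurable F → ∀ {B : ℝ}, (∀ z, |F z| ≤ B) →
    Measurable fun c => ∫ h, F (c, h) ∂(historyLaw c S n)
  | 0, F, hF, B, hB => by
    have : (fun c => ∫ h, F (c, h) ∂(historyLaw c S 0)) = fun c => F (c, ()) := by
      ext c
      exact integral_dirac' (fun h => F (c, h)) ()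
        (hF.comp measurable_prodMk_left).stronglyMeasurable
    rw [this]
    exact hF.comp measurable_prodMk_right
  | n + 1, F, hF, B, hB => by
    let F' : (CostFunction × History n) × (I × Bool) → ℝ := fun z => F (z.1.1, (z.1.2, z.2))
    have hF' : Measurable F' := by
      have hm : Measurable fun z : (CostFunction × History n) × (I × Bool) =>
          (z.1.1, (z.1.2, z.2)) := by fun_prop
      exact Measurable.comp (g := F) hF hm
    let G : CostFunction × History n → ℝ := fun z =>
      ∫ β, outcomeMean z.1 (fun x => F' (z, x)) β ∂(S.post n z.2)
    have hG : Measurable G := by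
      have := (measurable_outcomeMean measurable_fst hF').stronglyMeasurable
      exact (this.integral_kernel_prod_right'
        (κ := Kernel.prodMkLeft CostFunction (S.post n))).measurable
    have hGB : ∀ z, |G z| ≤ B := fun z =>
      abs_integral_le_of_abs_le fun β => abs_outcomeMean_le _ (fun x => hB _) β
    have := measurable_integral_historyLaw S n hG hGB
    convert this using 2 with c
    exact integral_historyLaw_succ c S n (F := fun z => F (c, z))
      (hF.comp measurable_prodMk_left) fun z => hB _

/-! ### Sums over the rounds of a history -/

/-- The sum of `g` over the rounds of a history. -/
def cumul (g : I × Bool → ℝ) : (n : ℕ) → History n → ℝ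
  | 0, _ => 0
  | n + 1, (h, x) => cumul g n h + g x

theorem measurable_cumul {g : I × Bool → ℝ} (hg : Measurable g) :
    (n : ℕ) → Measurable (cumul g n)
  | 0 => measurable_const
  | n + 1 => by
    have : Measurable fun z : History n × (I × Bool) => cumul g n z.1 + g z.2 :=
      ((measurable_cumul hg n).comp measurable_fst).add (hg.comp measurable_snd)
    exact this

theorem abs_cumul_le {g : I × Bool → ℝ} {B : ℝ} (hB : ∀ x, |g x| ≤ B) :
    (n : ℕ) → (h : History n) → |cumul g n h| ≤ n * B
  | 0, _ => by simp [cumul]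
  | n + 1, (h, x) => by
    have h1 := abs_cumul_le hB n h
    have h2 := hB x
    have h3 := abs_add_le (cumul g n h) (g x)
    simp only [cumul, Nat.cast_add, Nat.cast_one]
    linarith

theorem cumul_add_mul (a b : ℝ) (g : I × Bool → ℝ) : (n : ℕ) → (h : History n) →
    cumul (fun x => a + b * g x) n h = n * a + b * cumul g n h
  | 0, _ => by simp [cumul]
  | n + 1, (h, x) => by
    simp only [cumul, cumul_add_mul a b g n h, Nat.cast_add, Nat.cast_one]
    ring

theorem collected_eq_cumul : (n : ℕ) → (h : History n) →
    collected n h = cumul (fun x => (1 - (x.1 : ℝ)) * (if x.2 then 1 else 0)) n h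
  | 0, _ => rfl
  | n + 1, (h, β, y) => by simp only [collected, cumul, collected_eq_cumul n h]

theorem le_cumul_add_cumul {f g : I × Bool → ℝ} {a : ℝ} (hfg : ∀ x, a ≤ f x + g x) :
    (n : ℕ) → (h : History n) → n * a ≤ cumul f n h + cumul g n h
  | 0, _ => by simp [cumul]
  | n + 1, (h, x) => by
    have h1 := le_cumul_add_cumul hfg n h
    have h2 := hfg x
    simp only [cumul, Nat.cast_add, Nat.cast_one]
    linarith

theorem cumul_nonneg {g : I × Bool → ℝ} (hg : ∀ x, 0 ≤ g x) :
    (n : ℕ) → (h : History n) → 0 ≤ cumul g n h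
  | 0, _ => le_rfl
  | n + 1, (h, x) => add_nonneg (cumul_nonneg hg n h) (hg x)

theorem integrable_cumul (c : CostFunction) (S : Strategy) {g : I × Bool → ℝ} (hg : Measurable g)
    {B : ℝ} (hB : ∀ x, |g x| ≤ B) (n : ℕ) : Integrable (cumul g n) (historyLaw c S n) :=
  integrable_of_abs_le (measurable_cumul hg n) (abs_cumul_le hB n)

theorem integral_cumul_succ (c : CostFunction) (S : Strategy) {g : I × Bool → ℝ}
    (hg : Measurable g) {B : ℝ} (hB : ∀ x, |g x| ≤ B) (n : ℕ) :
    ∫ h, cumul g (n + 1) h ∂(historyLaw c S (n + 1)) = ∫ h, cumul g n h ∂(historyLaw c S n)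
      + ∫ h, ∫ β, outcomeMean c g β ∂(S.post n h) ∂(historyLaw c S n) := by
  have h1 := integral_historyLaw_succ c S n (F := fun z => cumul g n z.1 + g z.2)
    (((measurable_cumul hg n).comp measurable_fst).add (hg.comp measurable_snd))
    (B := n * B + B) fun z => (abs_add_le _ _).trans
      (add_le_add (abs_cumul_le hB n z.1) (hB z.2))
  have hm : Measurable (outcomeMean c g) :=
    (measurable_outcomeMean (α := Unit) (c := fun _ => c) measurable_const
      (F := fun z => g z.2) (hg.comp measurable_snd)).comp
      (measurable_const (a := ()) |>.prodMk measurable_id)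
  rw [← integral_add (integrable_cumul c S hg hB n)
    (integrable_of_abs_le hm.stronglyMeasurable.integral_kernel.measurable fun h =>
      abs_integral_le_of_abs_le (abs_outcomeMean_le c hB))]
  refine h1.trans (integral_congr_ae (.of_forall fun h => ?_))
  have h2 : ∀ β, outcomeMean c (fun x => cumul g n h + g x) β
      = cumul g n h + outcomeMean c g β := fun β => by unfold outcomeMean; ring
  simp only [h2]
  rw [integral_add (integrable_const _) (integrable_of_abs_le hm (abs_outcomeMean_le c hB))]
  simp

/-- Given the past and the posted contract, a round's outcome has conditional mean `outcomeMean`, so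
a comparison contract by contract suffices. Both the regret bound and the divergence bound come from
here. -/
theorem integral_cumul_mono (c : CostFunction) (S : Strategy) {f g : I × Bool → ℝ}
    (hf : Measurable f) (hg : Measurable g) {A B : ℝ} (hA : ∀ x, |f x| ≤ A)
    (hB : ∀ x, |g x| ≤ B) (hfg : ∀ β, outcomeMean c f β ≤ outcomeMean c g β) :
    ∀ n, ∫ h, cumul f n h ∂(historyLaw c S n) ≤ ∫ h, cumul g n h ∂(historyLaw c S n)
  | 0 => by simp [cumul]
  | n + 1 => by
    rw [integral_cumul_succ c S hf hA, integral_cumul_succ c S hg hB]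
    have hm : ∀ {g : I × Bool → ℝ}, Measurable g → Measurable (outcomeMean c g) := fun hg =>
      (measurable_outcomeMean (α := Unit) (c := fun _ => c) measurable_const
        (F := fun z => _) (hg.comp measurable_snd)).comp
        (measurable_const (a := ()) |>.prodMk measurable_id)
    refine add_le_add (integral_cumul_mono c S hf hg hA hB hfg n) (integral_mono ?_ ?_ fun h =>
      integral_mono ?_ ?_ hfg)
    · exact integrable_of_abs_le (hm hf).stronglyMeasurable.integral_kernel.measurable fun h =>
        abs_integral_le_of_abs_le (abs_outcomeMean_le c hA)
    · exact integrable_of_abs_le (hm hg).stronglyMeasurable.integral_kernel.measurable fun h =>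
        abs_integral_le_of_abs_le (abs_outcomeMean_le c hB)
    · exact integrable_of_abs_le (hm hf) (abs_outcomeMean_le c hA)
    · exact integrable_of_abs_le (hm hg) (abs_outcomeMean_le c hB)

/-! ### Change of measure between two cost functions -/

/-- `exp ∘ l` is the likelihood ratio of one outcome under `c'` and `c`. -/
def IsLogLikelihoodRatio (c c' : CostFunction) (l : I × Bool → ℝ) : Prop :=
  ∀ β : I, (response c' β : ℝ) = response c β * Real.exp (l (β, true)) ∧
    1 - (response c' β : ℝ) = (1 - response c β) * Real.exp (l (β, false))

theorem abs_exp_cumul_mul_le {l : I × Bool → ℝ} {A : ℝ} (hA : ∀ x, |l x| ≤ A) {n : ℕ}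
    {F : History n → ℝ} {B : ℝ} (hB : ∀ z, |F z| ≤ B) (h : History n) :
    |Real.exp (cumul l n h) * F h| ≤ Real.exp (n * A) * B := by
  rw [abs_mul, Real.abs_exp]
  exact mul_le_mul (Real.exp_le_exp.2 ((le_abs_self _).trans (abs_cumul_le hA n h))) (hB h)
    (abs_nonneg _) (Real.exp_pos _).le

/-- The strategy draws contracts from the same kernel under both costs, so only the outcome
probabilities enter the likelihood ratio of a history. -/
theorem integral_historyLaw_eq_of_isLogLikelihoodRatio {c c' : CostFunction} (S : Strategy)
    {l : I × Bool → ℝ} (hl : IsLogLikelihoodRatio c c' l) (hlm : Measurable l) {A : ℝ}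
    (hA : ∀ x, |l x| ≤ A) : ∀ (n : ℕ) {F : History n → ℝ}, Measurable F →
    ∀ {B : ℝ}, (∀ z, |F z| ≤ B) →
    ∫ h, F h ∂(historyLaw c' S n) = ∫ h, Real.exp (cumul l n h) * F h ∂(historyLaw c S n)
  | 0, F, hF, B, hB => by
    simp only [cumul, Real.exp_zero, one_mul]
    rfl
  | n + 1, F, hF, B, hB => by
    have h1 := integral_historyLaw_succ c' S n (F := F) hF hB
    have h2 := integral_historyLaw_succ c S n (F := fun z => Real.exp (cumul l (n + 1) z) * F z)
      ((measurable_cumul hlm (n + 1)).exp.mul hF) (abs_exp_cumul_mul_le hA hB)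
    have hm : Measurable fun h => ∫ β, outcomeMean c' (fun x => F (h, x)) β ∂(S.post n h) :=
      (measurable_outcomeMean (c := fun _ : History n => c') measurable_const
        (F := F) hF).stronglyMeasurable.integral_kernel_prod_right'.measurable
    have h3 := integral_historyLaw_eq_of_isLogLikelihoodRatio S hl hlm hA n hm (B := B) fun h =>
      abs_integral_le_of_abs_le (abs_outcomeMean_le c' fun x => hB (h, x))
    refine h1.trans (h3.trans (Eq.trans ?_ h2.symm))
    refine integral_congr_ae (.of_forall fun h => ?_)
    simp only
    rw [← integral_const_mul]
    refine integral_congr_ae (.of_forall fun β => ?_)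
    obtain ⟨e1, e2⟩ := hl β
    simp only [outcomeMean, cumul, Real.exp_add]
    rw [e2, e1]
    ring

/-! ### Cost functions with a prescribed marginal cost -/

theorem strictConvexOn_integral {f : ℝ → ℝ} (hf : Continuous f) (hmono : StrictMono f) :
    StrictConvexOn ℝ Set.univ fun a => ∫ x in (0 : ℝ)..a, f x := by
  refine StrictMono.strictConvexOn_univ_of_deriv
    (intervalIntegral.continuous_primitive (fun a b => hf.intervalIntegrable a b) 0) ?_
  have : deriv (fun a => ∫ x in (0 : ℝ)..a, f x) = f := funext fun a => hf.deriv_integral f 0 a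
  rwa [this]

/-- The cost function with marginal cost `f`. -/
def CostFunction.ofMarginal (f : ℝ → ℝ) (hf : Continuous f) (hmono : StrictMono f)
    (h0 : f 0 = 0) : CostFunction where
  toFun a := ∫ x in (0 : ℝ)..a, f x
  map_zero := by simp
  continuousOn :=
    (intervalIntegral.continuous_primitive (fun a b => hf.intervalIntegrable a b) 0).continuousOn
  monotoneOn := by
    intro a ha b hb hab
    have h := intervalIntegral.integral_add_adjacent_intervals
      (hf.intervalIntegrable (μ := volume) 0 a) (hf.intervalIntegrable a b)
    have h2 : 0 ≤ ∫ x in a..b, f x := intervalIntegral.integral_nonneg hab fun x hx => by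
      rw [← h0]; exact hmono.monotone (ha.1.trans hx.1)
    simp only
    linarith
  strictConvexOn := (strictConvexOn_integral hf hmono).subset (Set.subset_univ _)
    (convex_Icc 0 1)

/-- The first-order condition suffices: since the marginal cost increases, the cost lies above its
tangent of slope `β` at `a`. -/
theorem response_ofMarginal {f : ℝ → ℝ} (hf : Continuous f) (hmono : StrictMono f)
    (h0 : f 0 = 0) {β a : I} (h : f a = β) :
    response (.ofMarginal f hf hmono h0) β = a := by
  refine (IsBestResponse.eq_response fun a' => ?_).symm
  have hab := intervalIntegral.integral_add_adjacent_intervals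
    (hf.intervalIntegrable (μ := volume) 0 a) (hf.intervalIntegrable a a')
  have hc : ∫ _ in (a : ℝ)..a', (β : ℝ) = (a' - a) * β := by simp
  have key : (a' - a : ℝ) * β ≤ ∫ x in (a : ℝ)..a', f x := by
    rw [← hc]
    rcases le_total (a : ℝ) a' with hle | hle
    · exact intervalIntegral.integral_mono_on hle (by simp) (hf.intervalIntegrable _ _)
        fun x hx => h ▸ hmono.monotone hx.1
    · rw [intervalIntegral.integral_symm, intervalIntegral.integral_symm (a' : ℝ) a]
      exact neg_le_neg (intervalIntegral.integral_mono_on hle (hf.intervalIntegrable _ _)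
        (by simp) fun x hx => h ▸ hmono.monotone hx.2)
  simp only [agentUtility, CostFunction.ofMarginal]
  linarith

/-! ### The hard family of costs -/

/-- A marginal cost function whose optimal linear contract is `1 - d`. -/
def marginal (d x : ℝ) : ℝ := min (8 * x) (1 - 2 * d + 16 * d ^ 2 * x)

theorem continuous_marginal (d : ℝ) : Continuous (marginal d) := by
  unfold marginal; fun_prop

theorem strictMono_marginal {d : ℝ} (hd : d ∈ Set.Icc (1 / 4 : ℝ) (3 / 8)) :
    StrictMono (marginal d) := by
  intro x y hxy
  have : 0 < 16 * d ^ 2 := by have := hd.1; positivity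
  exact min_lt_min (by linarith) (by nlinarith)

theorem marginal_zero {d : ℝ} (hd : d ∈ Set.Icc (1 / 4 : ℝ) (3 / 8)) : marginal d 0 = 0 := by
  have := hd.2
  simp only [marginal, mul_zero, add_zero]
  exact min_eq_left (by linarith)

theorem quarter_le : (1 / 4 : ℝ) ≤ 3 / 8 := by norm_num

/-- The cost function with marginal cost `marginal d`, where `d` is projected to `[1/4, 3/8]`. -/
def cost (d : ℝ) : CostFunction :=
  .ofMarginal (marginal (Set.projIcc (1 / 4) (3 / 8) quarter_le d)) (continuous_marginal _)
    (strictMono_marginal (Subtype.prop _)) (marginal_zero (Subtype.prop _))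

/-- The line that the response to `cost d` follows near the optimal contract. -/
def line (d β : ℝ) : ℝ := (β - 1 + 2 * d) / (16 * d ^ 2)

/-- At `β = 1` the line has height `1 / (8 * d)`, and `d ≥ 1/4`. Failure thus always keeps
probability at least `1/2`. -/
theorem line_le_half {d β : ℝ} (hd : d ∈ Set.Icc (1 / 4 : ℝ) (3 / 8)) (hβ : β ≤ 1) :
    line d β ≤ 1 / 2 := by
  obtain ⟨h1, h2⟩ := hd
  unfold line
  rw [div_le_iff₀ (by positivity)]
  nlinarith

theorem response_cost {d : ℝ} (hd : d ∈ Set.Icc (1 / 4 : ℝ) (3 / 8)) (β : I) :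
    (response (cost d) β : ℝ) = max ((β : ℝ) / 8) (line d β) := by
  have hβ0 := β.2.1
  have hβ1 := β.2.2
  have hl := line_le_half hd hβ1
  have hmem : max ((β : ℝ) / 8) (line d β) ∈ Set.Icc (0 : ℝ) 1 :=
    ⟨le_max_of_le_left (by positivity), max_le (by linarith) (by linarith)⟩
  have hpos : 0 < 16 * d ^ 2 := by have := hd.1; positivity
  have hle8 : 16 * d ^ 2 ≤ 8 := by nlinarith [hd.1, hd.2]
  have hline : 16 * d ^ 2 * line d β = β - 1 + 2 * d := mul_div_cancel₀ _ hpos.ne'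
  have hm : marginal d (max ((β : ℝ) / 8) (line d β)) = β := by
    unfold marginal
    rcases le_total ((β : ℝ) / 8) (line d β) with h | h
    · rw [max_eq_right h, min_eq_right] <;> linarith
    · rw [max_eq_left h, min_eq_left]
      · ring
      · nlinarith
  have : response (cost d) β = ⟨_, hmem⟩ :=
    response_ofMarginal _ _ _ (by rw [Set.projIcc_of_mem _ hd]; exact hm)
  rw [this]

theorem measurable_cost : Measurable cost := by
  refine Measurable.of_comap_le ?_
  rw [show (instMeasurableSpaceCostFunction : MeasurableSpace CostFunction) =
    MeasurableSpace.comap (fun (c : CostFunction) (a : I) => c a) MeasurableSpace.pi from rfl,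
    MeasurableSpace.comap_comp]
  refine Measurable.comap_le (measurable_pi_lambda _ fun a => ?_)
  have hm : Continuous (Function.uncurry fun (d : ℝ) (x : ℝ) =>
      marginal (Set.projIcc (1 / 4) (3 / 8) quarter_le d) x) := by
    have : Continuous fun d : ℝ => ((Set.projIcc (1 / 4) (3 / 8) quarter_le d : _) : ℝ) :=
      continuous_subtype_val.comp continuous_projIcc
    unfold marginal Function.uncurry
    fun_prop
  exact (intervalIntegral.continuous_parametric_intervalIntegral_of_continuous' hm 0 a).measurable

theorem sq_le_principalUtility_gap {d : ℝ} (hd : d ∈ Set.Icc (1 / 4 : ℝ) (3 / 8)) (β : I) :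
    principalUtility (cost d) β ≤ 1 / 16 - 1 / 32 * ((β : ℝ) - (1 - d)) ^ 2 := by
  have hβ0 := β.2.1
  have hβ1 := β.2.2
  obtain ⟨h1, h2⟩ := hd
  rw [principalUtility, response_cost ⟨h1, h2⟩, mul_max_of_nonneg _ _ (sub_nonneg.2 hβ1)]
  refine max_le ?_ ?_
  -- On the branch `β / 8` the utility is at most `1/32`, and the squared deviation is at most `1`.
  · nlinarith [sq_nonneg ((β : ℝ) - 1 / 2)]
  · have : (1 - (β : ℝ)) * line d β = 1 / 16 - ((β : ℝ) - (1 - d)) ^ 2 / (16 * d ^ 2) := by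
      unfold line; field_simp; ring
    rw [this, div_eq_inv_mul _ (16 * d ^ 2)]
    have h3 : 1 / 32 ≤ (16 * d ^ 2)⁻¹ := by
      rw [one_div]; exact inv_anti₀ (by positivity) (by nlinarith)
    nlinarith [sq_nonneg ((β : ℝ) - (1 - d))]

theorem le_iSup_principalUtility_cost {d : ℝ} (hd : d ∈ Set.Icc (1 / 4 : ℝ) (3 / 8)) :
    1 / 16 ≤ ⨆ β : I, principalUtility (cost d) β := by
  have hmem : 1 - d ∈ Set.Icc (0 : ℝ) 1 := ⟨by linarith [hd.2], by linarith [hd.1]⟩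
  refine le_trans ?_ (le_ciSup (bddAbove_principalUtility (cost d)) ⟨1 - d, hmem⟩)
  rw [principalUtility, response_cost hd]
  have hne : d ≠ 0 := by linarith [hd.1]
  have h1 : (1 - (1 - d)) * line d (1 - d) = 1 / 16 := by unfold line; field_simp; ring
  rw [← h1]
  exact mul_le_mul_of_nonneg_left (le_max_right _ _) (by linarith [hd.1])

/-- Tangents to one curve: at the tangency point `β = 1 - d` the first-order change in the parameter
vanishes, so the difference carries a second small factor. -/
theorem abs_line_sub_line_le {d e : ℝ} (hd : d ∈ Set.Icc (1 / 4 : ℝ) (3 / 8))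
    (he : e ∈ Set.Icc (1 / 4 : ℝ) (3 / 8)) (β : ℝ) :
    |line e β - line d β| ≤ 12 * |e - d| * (|e - d| + |β - (1 - d)|) := by
  obtain ⟨h1, h2⟩ := hd
  obtain ⟨h3, h4⟩ := he
  have key : line e β - line d β
      = (e - d) * (-(d * (e - d)) - (β - (1 - d)) * (e + d)) / (16 * d ^ 2 * e ^ 2) := by
    unfold line; field_simp; ring
  have hden : 1 / 16 ≤ 16 * d ^ 2 * e ^ 2 := by
    have hd2 : 1 / 16 ≤ d ^ 2 := by nlinarith
    have he2 : 1 / 16 ≤ e ^ 2 := by nlinarith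
    nlinarith
  rw [key, abs_div, abs_mul, abs_of_pos (by positivity : 0 < 16 * d ^ 2 * e ^ 2),
    div_le_iff₀ (by positivity)]
  have h5 : |-(d * (e - d)) - (β - (1 - d)) * (e + d)|
      ≤ 3 / 4 * (|e - d| + |β - (1 - d)|) := by
    refine (abs_sub _ _).trans ?_
    rw [abs_neg, abs_mul, abs_mul, abs_of_pos (by linarith : 0 < d),
      abs_of_pos (by linarith : 0 < e + d)]
    nlinarith [abs_nonneg (e - d), abs_nonneg (β - (1 - d))]
  have h6 := abs_nonneg (e - d)
  have h7 : 0 ≤ |e - d| + |β - (1 - d)| := by positivity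
  calc _ ≤ |e - d| * (3 / 4 * (|e - d| + |β - (1 - d)|)) := mul_le_mul_of_nonneg_left h5 h6
    _ = 12 * |e - d| * (|e - d| + |β - (1 - d)|) * (1 / 16) := by ring
    _ ≤ _ := mul_le_mul_of_nonneg_left hden (by positivity)

theorem sq_response_sub_le {d e : ℝ} (hd : d ∈ Set.Icc (1 / 4 : ℝ) (3 / 8))
    (he : e ∈ Set.Icc (1 / 4 : ℝ) (3 / 8)) (β : I) :
    ((response (cost d) β : ℝ) - response (cost e) β) ^ 2
      ≤ 288 * (e - d) ^ 2 * ((e - d) ^ 2 + ((β : ℝ) - (1 - d)) ^ 2) := by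
  rw [response_cost hd, response_cost he]
  have h1 : |max ((β : ℝ) / 8) (line d β) - max ((β : ℝ) / 8) (line e β)|
      ≤ 12 * |e - d| * (|e - d| + |(β : ℝ) - (1 - d)|) := by
    refine le_trans ?_ (abs_line_sub_line_le hd he β)
    rw [abs_sub_comm (line e β)]
    refine (abs_max_sub_max_le_max _ _ _ _).trans ?_
    simp
  rw [← sq_abs, ← sq_abs (e - d), ← sq_abs ((β : ℝ) - (1 - d))]
  refine (pow_le_pow_left₀ (abs_nonneg _) h1 2).trans ?_
  have h2 : (|e - d| + |(β : ℝ) - (1 - d)|) ^ 2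
      ≤ 2 * (|e - d| ^ 2 + |(β : ℝ) - (1 - d)| ^ 2) := add_sq_le
  rw [mul_pow, mul_pow]
  nlinarith [mul_le_mul_of_nonneg_left h2 (sq_nonneg |e - d|)]

theorem response_cost_le_half {d : ℝ} (hd : d ∈ Set.Icc (1 / 4 : ℝ) (3 / 8)) (β : I) :
    (response (cost d) β : ℝ) ≤ 1 / 2 := by
  rw [response_cost hd]
  exact max_le (by linarith [β.2.2]) (line_le_half hd β.2.2)

/-- This is the purpose of the branch `8 * x` in `marginal`: wherever two costs may respond
differently, both success probabilities stay away from `0`, so log-likelihood ratios are bounded. -/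
theorem response_cost_eq_or_le {d e : ℝ} (hd : d ∈ Set.Icc (1 / 4 : ℝ) (3 / 8))
    (he : e ∈ Set.Icc (1 / 4 : ℝ) (3 / 8)) (β : I) :
    (response (cost d) β : ℝ) = response (cost e) β ∨
      1 / 32 ≤ (response (cost d) β : ℝ) ∧ 1 / 32 ≤ (response (cost e) β : ℝ) := by
  rw [response_cost hd, response_cost he]
  -- For `β ≤ 1/4` and `d ≤ 3/8` one has `β - 1 + 2 * d ≤ 0`, so the line is inactive for both
  -- parameters.
  rcases le_total (1 / 4) (β : ℝ) with h | h
  · exact .inr ⟨le_max_of_le_left (by linarith), le_max_of_le_left (by linarith)⟩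
  · have hneg : ∀ d ∈ Set.Icc (1 / 4 : ℝ) (3 / 8), line d β ≤ β / 8 := by
      rintro d ⟨h1, h2⟩
      refine le_trans (div_nonpos_of_nonpos_of_nonneg (by linarith) (by positivity)) ?_
      linarith [β.2.1]
    rw [max_eq_left (hneg d hd), max_eq_left (hneg e he)]
    exact .inl rfl

/-! ### Regret dominates the squared deviation from the optimal contract -/

theorem measurable_collected (n : ℕ) : Measurable (collected n) := by
  have h : Measurable fun x : I × Bool => (1 - (x.1 : ℝ)) * (if x.2 then 1 else 0) :=
    (measurable_const.sub (measurable_subtype_coe.comp measurable_fst)).mul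
      ((measurable_of_finite fun y : Bool => if y then (1 : ℝ) else 0).comp measurable_snd)
  rw [funext (collected_eq_cumul n)]
  exact measurable_cumul h n

theorem abs_reward_le (x : I × Bool) : |(1 - (x.1 : ℝ)) * (if x.2 then 1 else 0)| ≤ 1 := by
  have h0 := x.1.2.1
  have h1 := x.1.2.2
  rw [abs_le]
  split_ifs <;> constructor <;> linarith

theorem abs_collected_le (n : ℕ) (h : History n) : |collected n h| ≤ n := by
  rw [collected_eq_cumul]
  simpa using abs_cumul_le abs_reward_le n h

theorem measurable_regret (S : Strategy) (T : ℕ) : Measurable fun c => regret c S T :=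
  (measurable_iSup_principalUtility.const_mul _).sub (measurable_integral_historyLaw S T
    (F := fun z => collected T z.2) ((measurable_collected T).comp measurable_snd)
    fun z => abs_collected_le T z.2)

theorem abs_regret_le (c : CostFunction) (S : Strategy) (T : ℕ) : |regret c S T| ≤ 2 * T := by
  have h1 : |∫ h, collected T h ∂(historyLaw c S T)| ≤ T :=
    abs_integral_le_of_abs_le (abs_collected_le T)
  have h2 : (⨆ β : I, principalUtility c β) ≤ 1 := ciSup_le fun β => (principalUtility_mem c β).2
  have h3 : 0 ≤ ⨆ β : I, principalUtility c β :=
    (principalUtility_mem c 0).1.trans (le_ciSup (bddAbove_principalUtility c) 0)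
  have hT : (0 : ℝ) ≤ T := T.cast_nonneg
  rw [abs_le] at h1 ⊢
  unfold regret
  constructor <;> nlinarith

/-- Squared distance of the contract to `1 - d`. -/
def sqDev (d : ℝ) (x : I × Bool) : ℝ := ((x.1 : ℝ) - (1 - d)) ^ 2

theorem measurable_sqDev (d : ℝ) : Measurable (sqDev d) :=
  ((measurable_subtype_coe.comp measurable_fst).sub_const _).pow_const 2

theorem abs_sqDev_le {d : ℝ} (hd : d ∈ Set.Icc (1 / 4 : ℝ) (3 / 8)) (x : I × Bool) :
    |sqDev d x| ≤ 1 := by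
  have h0 := x.1.2.1
  have h1 := x.1.2.2
  obtain ⟨h2, h3⟩ := hd
  unfold sqDev
  rw [abs_of_nonneg (sq_nonneg _)]
  nlinarith

/-- The expected sum of the squared distances of the posted contracts to the optimal one. -/
def totalSqDev (d : ℝ) (S : Strategy) (n : ℕ) : ℝ :=
  ∫ h, cumul (sqDev d) n h ∂(historyLaw (cost d) S n)

theorem totalSqDev_nonneg (d : ℝ) (S : Strategy) (n : ℕ) : 0 ≤ totalSqDev d S n :=
  integral_nonneg fun h => cumul_nonneg (fun _ => sq_nonneg _) n h

theorem integral_cumul_add_mul (c : CostFunction) (S : Strategy) {g : I × Bool → ℝ}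
    (hg : Measurable g) {B : ℝ} (hB : ∀ x, |g x| ≤ B) (a b : ℝ) (n : ℕ) :
    ∫ h, cumul (fun x => a + b * g x) n h ∂(historyLaw c S n)
      = n * a + b * ∫ h, cumul g n h ∂(historyLaw c S n) := by
  simp_rw [cumul_add_mul]
  rw [integral_add (integrable_const _) ((integrable_cumul c S hg hB n).const_mul _),
    integral_const, integral_const_mul, probReal_univ, one_smul]

theorem abs_add_mul_le {α : Type*} {g : α → ℝ} {B : ℝ} (hB : ∀ x, |g x| ≤ B) (a b : ℝ) (x : α) :
    |a + b * g x| ≤ |a| + |b| * B := by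
  refine (abs_add_le _ _).trans (add_le_add le_rfl ?_)
  rw [abs_mul]
  exact mul_le_mul_of_nonneg_left (hB x) (abs_nonneg b)

theorem totalSqDev_le_regret {d : ℝ} (hd : d ∈ Set.Icc (1 / 4 : ℝ) (3 / 8)) (S : Strategy)
    (T : ℕ) : 1 / 32 * totalSqDev d S T ≤ regret (cost d) S T := by
  have h1 := integral_cumul_mono (cost d) S
    (f := fun x => (1 - (x.1 : ℝ)) * (if x.2 then 1 else 0))
    (g := fun x => 1 / 16 + -(1 / 32) * sqDev d x)
    ((measurable_const.sub (measurable_subtype_coe.comp measurable_fst)).mul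
      ((measurable_of_finite fun y : Bool => if y then (1 : ℝ) else 0).comp measurable_snd))
    (((measurable_sqDev d).const_mul _).const_add _) abs_reward_le
    (abs_add_mul_le (abs_sqDev_le hd) _ _)
    (fun β => by
      have := sq_le_principalUtility_gap hd β
      simp only [outcomeMean, sqDev, principalUtility] at *
      simp only [if_true, Bool.false_eq_true, if_false]
      linarith) T
  rw [integral_cumul_add_mul (cost d) S (measurable_sqDev d) (abs_sqDev_le hd),
    ← funext (collected_eq_cumul T)] at h1
  have h2 := mul_le_mul_of_nonneg_left (le_iSup_principalUtility_cost hd) T.cast_nonneg (α := ℝ)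
  unfold regret totalSqDev
  linarith

/-! ### Log-likelihood ratios and divergence within the family -/

/-- The logarithm of the likelihood ratio of an outcome under `c'` and `c`. -/
def logRatio (c c' : CostFunction) (x : I × Bool) : ℝ :=
  if x.2 then Real.log ((response c' x.1 : ℝ) / response c x.1)
  else Real.log ((1 - (response c' x.1 : ℝ)) / (1 - response c x.1))

theorem measurable_logRatio (c c' : CostFunction) : Measurable (logRatio c c') := by
  have hr : ∀ c, Measurable fun x : I × Bool => (response c x.1 : ℝ) := fun c =>
    measurable_subtype_coe.comp ((monotone_response c).measurable.comp measurable_fst)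
  refine Measurable.ite (measurable_snd (measurableSet_singleton true)) ?_ ?_
  · exact ((hr c').div (hr c)).log
  · exact ((measurable_const.sub (hr c')).div (measurable_const.sub (hr c))).log

theorem abs_log_div_le {a b : ℝ} (ha : 1 / 32 ≤ a) (ha1 : a ≤ 1) (hb : 1 / 32 ≤ b)
    (hb1 : b ≤ 1) : |Real.log (b / a)| ≤ 32 := by
  have key : ∀ {a b : ℝ}, 1 / 32 ≤ a → 1 / 32 ≤ b → b ≤ 1 → Real.log (b / a) ≤ 32 := by
    intro a b ha hb hb1
    have h1 := Real.log_le_sub_one_of_pos (x := b / a) (div_pos (by linarith) (by linarith))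
    have h2 : b / a ≤ 32 := by rw [div_le_iff₀ (by linarith)]; linarith
    linarith
  rw [abs_le]
  refine ⟨?_, key ha hb hb1⟩
  rw [← inv_div, Real.log_inv]
  exact neg_le_neg (key hb ha ha1)

theorem log_div_self' (a : ℝ) : Real.log (a / a) = 0 := by
  rcases eq_or_ne a 0 with rfl | h
  · simp
  · simp [h]

theorem abs_logRatio_cost_le {d e : ℝ} (hd : d ∈ Set.Icc (1 / 4 : ℝ) (3 / 8))
    (he : e ∈ Set.Icc (1 / 4 : ℝ) (3 / 8)) (x : I × Bool) : |logRatio (cost d) (cost e) x| ≤ 32 := by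
  have h1 := response_cost_le_half hd x.1
  have h2 := response_cost_le_half he x.1
  unfold logRatio
  split_ifs
  · rcases response_cost_eq_or_le hd he x.1 with h | ⟨h3, h4⟩
    · rw [h, log_div_self']; simp
    · exact abs_log_div_le h3 (by linarith) h4 (by linarith)
  · exact abs_log_div_le (by linarith) (by linarith [(response (cost d) x.1).2.1]) (by linarith)
      (by linarith [(response (cost e) x.1).2.1])

theorem isLogLikelihoodRatio_cost {d e : ℝ} (hd : d ∈ Set.Icc (1 / 4 : ℝ) (3 / 8))
    (he : e ∈ Set.Icc (1 / 4 : ℝ) (3 / 8)) :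
    IsLogLikelihoodRatio (cost d) (cost e) (logRatio (cost d) (cost e)) := by
  intro β
  have h1 := response_cost_le_half hd β
  have h2 := response_cost_le_half he β
  simp only [logRatio, if_true, Bool.false_eq_true, if_false]
  constructor
  · rcases response_cost_eq_or_le hd he β with h | ⟨h3, h4⟩
    · rw [h, log_div_self']; simp
    · rw [Real.exp_log (div_pos (by linarith) (by linarith))]
      exact (mul_div_cancel₀ _ (by linarith)).symm
  · rw [Real.exp_log (div_pos (by linarith) (by linarith))]
    exact (mul_div_cancel₀ _ (by linarith)).symm

/-- The left side is the Kullback-Leibler divergence of one outcome, bounded by the chi-square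
divergence `(p - q)² / (q (1 - q))` through `log x ≤ x - 1`. The constant is `64 * 288`: the first
factor from `q ≥ 1/32` and `1 - q ≥ 1/2`, the second from `sq_response_sub_le`. -/
theorem outcomeMean_neg_logRatio_le {d e : ℝ} (hd : d ∈ Set.Icc (1 / 4 : ℝ) (3 / 8))
    (he : e ∈ Set.Icc (1 / 4 : ℝ) (3 / 8)) (β : I) :
    outcomeMean (cost d) (fun x => 0 + -1 * logRatio (cost d) (cost e) x) β
      ≤ 18432 * (e - d) ^ 2 * ((e - d) ^ 2 + ((β : ℝ) - (1 - d)) ^ 2) := by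
  have h1 := response_cost_le_half hd β
  have h2 := response_cost_le_half he β
  have hsq := sq_response_sub_le hd he β
  have hp0 := (response (cost d) β).2.1
  simp only [outcomeMean, logRatio, if_true, Bool.false_eq_true, if_false]
  rcases response_cost_eq_or_le hd he β with h | ⟨h3, h4⟩
  · rw [h, log_div_self', log_div_self']
    have : 0 ≤ 18432 * (e - d) ^ 2 * ((e - d) ^ 2 + ((β : ℝ) - (1 - d)) ^ 2) := by positivity
    linarith
  · generalize (response (cost d) β : ℝ) = p at *
    generalize (response (cost e) β : ℝ) = q at *
    have hq : 0 < q := by linarith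
    have hq1 : 0 < 1 - q := by linarith
    have e1 := Real.log_le_sub_one_of_pos (x := p / q) (div_pos (by linarith) hq)
    have e2 := Real.log_le_sub_one_of_pos (x := (1 - p) / (1 - q)) (div_pos (by linarith) hq1)
    rw [← inv_div, Real.log_inv, ← inv_div (1 - p), Real.log_inv]
    have e3 : p * (p / q - 1) + (1 - p) * ((1 - p) / (1 - q) - 1)
        = (p - q) ^ 2 / (q * (1 - q)) := by field_simp; ring
    have e4 : (p - q) ^ 2 / (q * (1 - q)) ≤ 64 * (p - q) ^ 2 := by
      rw [div_le_iff₀ (by positivity)]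
      have : 1 / 64 ≤ q * (1 - q) := by nlinarith
      nlinarith [mul_le_mul_of_nonneg_left this (sq_nonneg (p - q))]
    have e5 := mul_le_mul_of_nonneg_left e1 hp0
    have e6 := mul_le_mul_of_nonneg_left e2 (by linarith : (0 : ℝ) ≤ 1 - p)
    linarith

theorem neg_integral_cumul_logRatio_le {d e : ℝ} (hd : d ∈ Set.Icc (1 / 4 : ℝ) (3 / 8))
    (he : e ∈ Set.Icc (1 / 4 : ℝ) (3 / 8)) (S : Strategy) (n : ℕ) :
    -∫ h, cumul (logRatio (cost d) (cost e)) n h ∂(historyLaw (cost d) S n)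
      ≤ 18432 * (e - d) ^ 2 * (n * (e - d) ^ 2 + totalSqDev d S n) := by
  have h1 := integral_cumul_mono (cost d) S
    (f := fun x => 0 + -1 * logRatio (cost d) (cost e) x)
    (g := fun x => 18432 * (e - d) ^ 2 * (e - d) ^ 2 + 18432 * (e - d) ^ 2 * sqDev d x)
    (((measurable_logRatio _ _).const_mul _).const_add _)
    (((measurable_sqDev d).const_mul _).const_add _)
    (abs_add_mul_le (abs_logRatio_cost_le hd he) _ _) (abs_add_mul_le (abs_sqDev_le hd) _ _)
    (fun β => (outcomeMean_neg_logRatio_le hd he β).trans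
      (by simp only [outcomeMean, sqDev]; exact le_of_eq (by ring))) n
  rw [integral_cumul_add_mul _ S (measurable_sqDev d) (abs_sqDev_le hd),
    integral_cumul_add_mul _ S (measurable_logRatio _ _) (abs_logRatio_cost_le hd he)] at h1
  unfold totalSqDev
  linarith

/-! ### The two-point argument -/

/-- For `l` the log-likelihood ratio, the mean of `min 1 (exp l)` measures the overlap of the two
laws. The lower bound is affine in `l` and `exp l`, whose means are minus the divergence and `1`; so
the overlap is at least `3/8` minus a quarter of the divergence. -/
theorem le_min_one_exp (l : ℝ) : 7 / 16 + l / 4 - Real.exp l / 16 ≤ min 1 (Real.exp l) := by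
  have h1 := Real.add_one_le_exp (l / 2)
  have h2 : Real.exp l = Real.exp (l / 2) ^ 2 := by rw [← Real.exp_nat_mul]; congr 1; ring
  rw [h2]
  generalize Real.exp (l / 2) = x at *
  refine le_min ?_ ?_ <;> nlinarith [sq_nonneg (x - 4), sq_nonneg (x - 1 / 4)]

theorem le_totalSqDev_add_totalSqDev {d e : ℝ} (hd : d ∈ Set.Icc (1 / 4 : ℝ) (3 / 8))
    (he : e ∈ Set.Icc (1 / 4 : ℝ) (3 / 8)) (S : Strategy) (T : ℕ) :
    T * (e - d) ^ 2 / 2 * (3 / 8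
      - 4608 * (e - d) ^ 2 * (T * (e - d) ^ 2 + totalSqDev d S T))
      ≤ totalSqDev d S T + totalSqDev e S T := by
  set l := logRatio (cost d) (cost e)
  have hlm : Measurable l := measurable_logRatio _ _
  have hlB := abs_logRatio_cost_le hd he
  have hl := isLogLikelihoodRatio_cost hd he
  set P := historyLaw (cost d) S T
  have h1 : totalSqDev e S T = ∫ h, Real.exp (cumul l T h) * cumul (sqDev e) T h ∂P :=
    integral_historyLaw_eq_of_isLogLikelihoodRatio S hl hlm hlB T
      (measurable_cumul (measurable_sqDev e) T) (abs_cumul_le (abs_sqDev_le he) T)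
  have h2 : ∫ h, Real.exp (cumul l T h) ∂P = 1 := by
    have := integral_historyLaw_eq_of_isLogLikelihoodRatio S hl hlm hlB T
      (F := fun _ => 1) measurable_const (B := 1) (by simp)
    simpa using this.symm
  have hexp : Integrable (fun h => Real.exp (cumul l T h)) P := by
    refine integrable_of_abs_le (measurable_cumul hlm T).exp (B := Real.exp (T * 32) * 1)
      fun h => ?_
    simpa using abs_exp_cumul_mul_le hlB (F := fun _ => 1) (B := 1) (by simp) h
  have hint : Integrable (cumul l T) P := integrable_cumul _ S hlm hlB T
  have hadd : Integrable (fun h => 7 / 16 + cumul l T h / 4) P :=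
    (integrable_const _).add (hint.div_const 4)
  have hlin : Integrable (fun h => 7 / 16 + cumul l T h / 4 - Real.exp (cumul l T h) / 16) P :=
    hadd.sub (hexp.div_const 16)
  have h3 : ∫ h, (7 / 16 + cumul l T h / 4 - Real.exp (cumul l T h) / 16) ∂P
      = 3 / 8 + (∫ h, cumul l T h ∂P) / 4 := by
    rw [integral_sub hadd (hexp.div_const 16),
      integral_add (integrable_const _) (hint.div_const 4), integral_const, integral_div, integral_div, h2, probReal_univ,
      one_smul]
    ring
  have h4 := neg_integral_cumul_logRatio_le hd he S T
  have hTd : 0 ≤ T * (e - d) ^ 2 / 2 := by positivity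
  have h5 : T * (e - d) ^ 2 / 2
      * ∫ h, (7 / 16 + cumul l T h / 4 - Real.exp (cumul l T h) / 16) ∂P
      ≤ totalSqDev d S T + totalSqDev e S T := by
    have i1 : Integrable (cumul (sqDev d) T) P :=
      integrable_cumul _ S (measurable_sqDev d) (abs_sqDev_le hd) T
    have i2 : Integrable (fun h => Real.exp (cumul l T h) * cumul (sqDev e) T h) P :=
      integrable_of_abs_le ((measurable_cumul hlm T).exp.mul
        (measurable_cumul (measurable_sqDev e) T))
        (abs_exp_cumul_mul_le hlB (abs_cumul_le (abs_sqDev_le he) T))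
    rw [h1, totalSqDev, ← integral_add i1 i2, ← integral_const_mul]
    refine integral_mono (hlin.const_mul _) (i1.add i2) fun h => ?_
    have a1 := le_min_one_exp (cumul l T h)
    -- In each round the squared distances to `1 - d` and `1 - e` sum to at least `(e - d)² / 2`.
    have a2 : T * ((e - d) ^ 2 / 2) ≤ cumul (sqDev d) T h + cumul (sqDev e) T h :=
      le_cumul_add_cumul (fun x => by
        simp only [sqDev]; nlinarith [sq_nonneg (2 * (x.1 : ℝ) - 2 + d + e)]) T h
    have a3 := cumul_nonneg (g := sqDev d) (fun _ => sq_nonneg _) T h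
    have a4 := cumul_nonneg (g := sqDev e) (fun _ => sq_nonneg _) T h
    have a5 := min_le_left 1 (Real.exp (cumul l T h))
    have a6 := min_le_right 1 (Real.exp (cumul l T h))
    have a7 : 0 ≤ min 1 (Real.exp (cumul l T h)) := le_min zero_le_one (Real.exp_pos _).le
    calc _ ≤ T * (e - d) ^ 2 / 2 * min 1 (Real.exp (cumul l T h)) :=
          mul_le_mul_of_nonneg_left a1 hTd
      _ ≤ (cumul (sqDev d) T h + cumul (sqDev e) T h) * min 1 (Real.exp (cumul l T h)) :=
          mul_le_mul_of_nonneg_right (by linarith) a7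
      _ ≤ _ := by nlinarith [mul_le_mul_of_nonneg_left a5 a3,
          mul_le_mul_of_nonneg_left a6 a4]
  refine le_trans (mul_le_mul_of_nonneg_left ?_ hTd) h5
  rw [h3]
  linarith

theorem sqrt_le_totalSqDev_add_totalSqDev {d e : ℝ} (hd : d ∈ Set.Icc (1 / 4 : ℝ) (3 / 8))
    (he : e ∈ Set.Icc (1 / 4 : ℝ) (3 / 8)) (S : Strategy) (T : ℕ)
    (hde : (e - d) ^ 2 * √T = 1 / 65536) :
    √T / 524288 ≤ totalSqDev d S T + totalSqDev e S T := by
  have hy := Real.sqrt_nonneg (T : ℝ)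
  have hT : (T : ℝ) = √T * √T := (Real.mul_self_sqrt T.cast_nonneg).symm
  have h0 := totalSqDev_nonneg e S T
  -- If the deviation under `d` is already `√T` there is nothing to prove; otherwise the divergence
  -- is small.
  by_cases hW : √(T : ℝ) ≤ totalSqDev d S T
  · linarith
  · have h1 := le_totalSqDev_add_totalSqDev hd he S T
    have h2 : T * (e - d) ^ 2 = √T / 65536 := by
      rw [hT]
      simp only [Real.mul_self_sqrt T.cast_nonneg]
      nlinarith
    rw [h2] at h1
    have h3 := mul_le_mul_of_nonneg_left (not_le.1 hW).le (sq_nonneg (e - d))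
    -- With `(e - d)² * √T = 1 / 65536`, the subtracted term is about `4608 / 65536`, below `1/8`.
    have h4 : 1 / 4 ≤ 3 / 8 - 4608 * (e - d) ^ 2 * (√T / 65536 + totalSqDev d S T) := by
      nlinarith
    have h5 := mul_le_mul_of_nonneg_left h4 (by positivity : 0 ≤ √(T : ℝ) / 65536 / 2)
    linarith

/-! ### Averaging over the prior -/

theorem sqrt_le_intervalIntegral_regret (S : Strategy) (T : ℕ) :
    √T / 2 ^ 29 ≤ ∫ d in (1 / 4 : ℝ)..(3 / 8), regret (cost d) S T := by
  set R : ℝ → ℝ := fun d => regret (cost d) S T with hR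
  have hnn : ∀ d ∈ Set.Icc (1 / 4 : ℝ) (3 / 8), 0 ≤ R d := fun d hd =>
    le_trans (mul_nonneg (by norm_num) (totalSqDev_nonneg d S T)) (totalSqDev_le_regret hd S T)
  have hint : ∀ a b, IntervalIntegrable R volume a b := fun a b =>
    ⟨integrable_of_abs_le ((measurable_regret S T).comp measurable_cost)
      fun d => abs_regret_le _ S T, integrable_of_abs_le
      ((measurable_regret S T).comp measurable_cost) fun d => abs_regret_le _ S T⟩
  rcases T.eq_zero_or_pos with rfl | hTpos
  · simpa using intervalIntegral.integral_nonneg quarter_le hnn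
  have hT1 : (1 : ℝ) ≤ T := by exact_mod_cast hTpos
  have hy1 : 1 ≤ √(T : ℝ) := Real.one_le_sqrt.2 hT1
  have hz1 : 1 ≤ √√(T : ℝ) := Real.one_le_sqrt.2 hy1
  have hz2 : √√(T : ℝ) ^ 2 = √T := Real.sq_sqrt (Real.sqrt_nonneg _)
  -- The shift is of order `T^(-1/4)`; the factor `256` gives `δ² * √T = 1 / 65536` and keeps `δ`
  -- within half the length of the parameter interval.
  set δ : ℝ := 1 / (256 * √√(T : ℝ)) with hδ
  have hδ0 : 0 < δ := by positivity
  have hδ1 : δ ≤ 1 / 16 := by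
    rw [hδ]
    exact one_div_le_one_div_of_le (by norm_num) (by linarith)
  have hδ2 : δ ^ 2 * √T = 1 / 65536 := by
    rw [hδ, div_pow, mul_pow, hz2]; field_simp; norm_num
  have hpt : ∀ d ∈ Set.Icc (1 / 4 : ℝ) (3 / 8 - δ), √T / 2 ^ 24 ≤ R d + R (d + δ) := by
    rintro d ⟨h1, h2⟩
    have hd : d ∈ Set.Icc (1 / 4 : ℝ) (3 / 8) := ⟨h1, by linarith⟩
    have he : d + δ ∈ Set.Icc (1 / 4 : ℝ) (3 / 8) := ⟨by linarith, by linarith⟩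
    have h3 := sqrt_le_totalSqDev_add_totalSqDev hd he S T (by rw [add_sub_cancel_left, hδ2])
    have h4 := totalSqDev_le_regret hd S T
    have h5 := totalSqDev_le_regret he S T
    simp only [hR]
    linarith
  have hshift : IntervalIntegrable (fun d => R (d + δ)) volume (1 / 4) (3 / 8 - δ) := by
    have := (hint (1 / 4 + δ) (3 / 8)).comp_add_right δ
    rwa [add_sub_cancel_right] at this
  have h1 : (3 / 8 - δ - 1 / 4) * (√T / 2 ^ 24)
      ≤ ∫ d in (1 / 4 : ℝ)..(3 / 8 - δ), (R d + R (d + δ)) := by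
    have := intervalIntegral.integral_mono_on (μ := volume)
      (by linarith : (1 / 4 : ℝ) ≤ 3 / 8 - δ) (intervalIntegrable_const (c := √T / 2 ^ 24))
      ((hint _ _).add hshift) hpt
    rwa [intervalIntegral.integral_const, smul_eq_mul] at this
  -- After the change of variables the two terms are integrals of `R` over two subintervals, each at
  -- most the full integral since `R ≥ 0`. This costs a factor `2`.
  rw [intervalIntegral.integral_add (hint _ _) hshift,
    intervalIntegral.integral_comp_add_right, sub_add_cancel] at h1
  have h2 := intervalIntegral.integral_add_adjacent_intervals (hint (1 / 4) (3 / 8 - δ))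
    (hint (3 / 8 - δ) (3 / 8))
  have h3 := intervalIntegral.integral_add_adjacent_intervals (hint (1 / 4) (1 / 4 + δ))
    (hint (1 / 4 + δ) (3 / 8))
  have h4 : 0 ≤ ∫ d in (3 / 8 - δ)..(3 / 8), R d :=
    intervalIntegral.integral_nonneg (by linarith) fun d hd =>
      hnn d ⟨by linarith [hd.1], hd.2⟩
  have h5 : 0 ≤ ∫ d in (1 / 4)..(1 / 4 + δ), R d :=
    intervalIntegral.integral_nonneg (by linarith) fun d hd =>
      hnn d ⟨hd.1, by linarith [hd.2]⟩
  have h6 : 1 / 16 * (√T / 2 ^ 24) ≤ (3 / 8 - δ - 1 / 4) * (√T / 2 ^ 24) :=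
    mul_le_mul_of_nonneg_right (by linarith) (by positivity)
  linarith

/-- The law of `cost d` for `d` uniform on `[1/4, 3/8]`. -/
def prior : Measure CostFunction :=
  ((8 : ENNReal) • volume.restrict (Set.Ioc (1 / 4 : ℝ) (3 / 8))).map cost

instance : IsProbabilityMeasure prior := by
  have : IsProbabilityMeasure
      ((8 : ENNReal) • volume.restrict (Set.Ioc (1 / 4 : ℝ) (3 / 8))) := ⟨by
    simp only [Measure.smul_apply, Measure.restrict_apply_univ, Real.volume_Ioc, smul_eq_mul]
    rw [← ENNReal.ofReal_ofNat, ← ENNReal.ofReal_mul (by norm_num)]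
    norm_num⟩
  exact Measure.isProbabilityMeasure_map measurable_cost.aemeasurable

theorem integral_prior {f : CostFunction → ℝ} (hf : Measurable f) :
    ∫ c, f c ∂prior = 8 * ∫ d in (1 / 4 : ℝ)..(3 / 8), f (cost d) := by
  rw [prior, integral_map measurable_cost.aemeasurable hf.aestronglyMeasurable,
    integral_smul_measure, intervalIntegral.integral_of_le quarter_le]
  simp

end LinearContract

end

theorem mainTheorem7 :
    ∃ μ : MeasureTheory.Measure LinearContract.CostFunction,
      MeasureTheory.IsProbabilityMeasure μ ∧
      ∃ C : ℝ, 0 < C ∧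
        ∀ (T : ℕ) (S : LinearContract.Strategy),
          MeasureTheory.Integrable (fun c => LinearContract.regret c S T) μ ∧
          C * Real.sqrt T ≤ ∫ c, LinearContract.regret c S T ∂μ := by
  refine ⟨LinearContract.prior, inferInstance, 1 / 2 ^ 26, by norm_num, fun T S =>
    ⟨LinearContract.integrable_of_abs_le (LinearContract.measurable_regret S T)
      fun c => LinearContract.abs_regret_le c S T, ?_⟩⟩
  rw [LinearContract.integral_prior (LinearContract.measurable_regret S T)]
  linarith [LinearContract.sqrt_le_intervalIntegral_regret S T]
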